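/- Let $p\equiv 3 \pmod 4$ be a prime, let $m,l\ge 1$ be integers, $e=2m$, $q=p^e$ and $s=\gcd(l,e)$, and assume that $e/s$ is even and $m/s$ is odd (evenness of $e/s$ means that $s\mid m$). Let $\mathrm{Tr}$ be the trace from $\mathbb{F}_q$ to $\mathbb{F}_p$, and let $C_0$ and $C_1$ be the sets of squares and of non-squares in $\mathbb{F}_p^*$, respectively. For $i\in\{0,1\}$ put $$D_i=\{(x_1,x_2)\in\mathbb{F}_q^2 : \mathrm{Tr}(x_1^{p^l+1})=1,\ \mathrm{Tr}(x_2)\in C_i\},$$ $$\mathcal{C}_{D_i}=\{(\mathrm{Tr}(ax_1+bx_2))_{(x_1,x_2)\in D_i} : a,b\in\mathbb{F}_q\}.$$ Then the linear code $\mathcal{C}_{D_i}$ over $\mathbb{F}_p$ has length $|D_i|=\frac{p-1}{2}(p^{2e-2}+p^{e+m-2})$ and dimension $2e$, and its weight distribution is given by the following table of Hamming weights and multiplicities: $$\begin{array}{ll} \text{Weight} & \text{Multiplicity}\\ 0 & 1\\ \frac{p-1}{2}(p^{2e-2}+p^{e+m-2}) & p-1\\ \frac{(p-1)^2}{2}(p^{2e-3}+p^{e+m-3})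 & p^e(p^e-p)\\ \frac{(p-1)^2}{2}p^{2e-3} & (p^e+p^{e-1}-p^m+p^{m-1}-2)/2\\ \frac{(p-1)^2}{2}p^{2e-3}+(p-1)p^{e+m-2} & (p^e-p^{e-1}+p^m-p^{m-1})/2\\ \frac{(p-1)^2}{2}p^{2e-3}+\frac{p-1}{2}p^{e+m-2} & (p-1)(p^e+p^{e-1}-p^m+p^{m-1}-2)/2\\ \frac{(p-1)^2}{2}p^{2e-3}+\frac{p-3}{2}p^{e+m-2} & (p-1)(p^e-p^{e-1}+p^m-p^{m-1})/2 \end{array}$$ Here, if several rows have the same weight for particular values of the parameters, the multiplicities of these rows are added, and no codeword has a weight that is not in the table. In particular, $\mathcal{C}_{D_i}$ has at most six distinct nonzero weights, and at most five if $m=s=1$. -/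

import Mathlib

/-- The cyclotomic classes of order two in the multiplicative group of `ZMod p`:
`i = 0` gives the nonzero squares, `i = 1` the non-squares. -/
def cyclotomicClass (p : ℕ) (i : Fin 2) : Set (ZMod p) :=
  {c | c ≠ 0 ∧ (IsSquare c ↔ i = 0)}

open Classical in
/-- The defining set `D_i` of all `(x₁, x₂)` in `F × F` such that `Tr (x₁ ^ (p ^ l + 1)) = 1`
and `Tr x₂` lies in the cyclotomic class with index `i`. -/
noncomputable def definingSet (p : ℕ) (F : Type*) [Field F] [Fintype F] [Algebra (ZMod p) F]
    (l : ℕ) (i : Fin 2) : Finset (F × F) :=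
  Finset.univ.filter fun x =>
    Algebra.trace (ZMod p) F (x.1 ^ (p ^ l + 1)) = 1 ∧
      Algebra.trace (ZMod p) F x.2 ∈ cyclotomicClass p i

/-- The linear code over `ZMod p` with defining set `D`: all words
`(Tr (a x₁ + b x₂))` with `(x₁, x₂)` running through `D`, for `a`, `b` in `F`.
Its coordinates are indexed by the elements of `D`, so that its length is the size of `D`. -/
noncomputable def traceCode (p : ℕ) {F : Type*} [Field F] [Algebra (ZMod p) F]
    (D : Finset (F × F)) : Submodule (ZMod p) (D → ZMod p) where
  carrier := {c | ∃ a b : F, ∀ x : D, c x = Algebra.trace (ZMod p) F (a * x.1.1 + b * x.1.2)}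
  zero_mem' := ⟨0, 0, fun x => by simp⟩
  add_mem' := by
    rintro c d ⟨a, b, h⟩ ⟨a', b', h'⟩
    refine ⟨a + a', b + b', fun x => ?_⟩
    rw [Pi.add_apply, h x, h' x, ← map_add]
    congr 1
    ring
  smul_mem' := by
    rintro r c ⟨a, b, h⟩
    refine ⟨r • a, r • b, fun x => ?_⟩
    rw [Pi.smul_apply, h x, ← map_smul, smul_add, smul_mul_assoc, smul_mul_assoc]

/-- The number of codewords of Hamming weight `w` in the code `C`. -/
noncomputable def weightCount {K ι : Type*} [Field K] [DecidableEq K] [Fintype ι]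
    (C : Submodule K (ι → K)) (w : ℕ) : ℕ :=
  Set.ncard {c : ι → K | c ∈ C ∧ hammingNorm c = w}

/-- The set of nonzero Hamming weights that occur in the code `C`. -/
def nonzeroWeights {K ι : Type*} [Field K] [DecidableEq K] [Fintype ι]
    (C : Submodule K (ι → K)) : Set ℕ :=
  {w | w ≠ 0 ∧ ∃ c ∈ C, hammingNorm c = w}

/-- The rows (weight, multiplicity) of the table of the weight distribution, as rational numbers.
Distinct rows may have the same weight for particular values of the parameters;
their multiplicities are then to be added. -/
def weightTable (p e m : ℕ) : Fin 7 → ℚ × ℚ :=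
  ![(0, 1),
    (((p : ℚ) - 1) / 2 * ((p : ℚ) ^ (2 * e - 2) + (p : ℚ) ^ (e + m - 2)),
      (p : ℚ) - 1),
    (((p : ℚ) - 1) ^ 2 / 2 * ((p : ℚ) ^ (2 * e - 3) + (p : ℚ) ^ (e + m - 3)),
      (p : ℚ) ^ e * ((p : ℚ) ^ e - p)),
    (((p : ℚ) - 1) ^ 2 / 2 * (p : ℚ) ^ (2 * e - 3),
      ((p : ℚ) ^ e + (p : ℚ) ^ (e - 1) - (p : ℚ) ^ m + (p : ℚ) ^ (m - 1) - 2) / 2),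
    (((p : ℚ) - 1) ^ 2 / 2 * (p : ℚ) ^ (2 * e - 3) + ((p : ℚ) - 1) * (p : ℚ) ^ (e + m - 2),
      ((p : ℚ) ^ e - (p : ℚ) ^ (e - 1) + (p : ℚ) ^ m - (p : ℚ) ^ (m - 1)) / 2),
    (((p : ℚ) - 1) ^ 2 / 2 * (p : ℚ) ^ (2 * e - 3)
        + ((p : ℚ) - 1) / 2 * (p : ℚ) ^ (e + m - 2),
      ((p : ℚ) - 1) *
        ((p : ℚ) ^ e + (p : ℚ) ^ (e - 1) - (p : ℚ) ^ m + (p : ℚ) ^ (m - 1) - 2) / 2),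
    (((p : ℚ) - 1) ^ 2 / 2 * (p : ℚ) ^ (2 * e - 3)
        + ((p : ℚ) - 3) / 2 * (p : ℚ) ^ (e + m - 2),
      ((p : ℚ) - 1) *
        ((p : ℚ) ^ e - (p : ℚ) ^ (e - 1) + (p : ℚ) ^ m - (p : ℚ) ^ (m - 1)) / 2)]

/-! Put $Q(x)=\mathrm{Tr}(x^{p^l+1})$, a quadratic form on $\mathbb{F}_q$ over $\mathbb{F}_p$, and
write $m=sk$, $l=sj$ with $k,j$ odd. Everything rests on the Gauss sums $S_y=\sum_x\psi(yQ(x))$,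
which equal $-p^m$ for every $y\ne0$ (`gaussSum_frobeniusTraceForm`). They do not depend on $y$,
since each $y\in\mathbb{F}_p^*$ is a $(p^l+1)$-th power in $\mathbb{F}_q$. As $Q$ is nondegenerate,
$S_1^2=S_1S_{-1}=q$. The sign follows from a congruence: $p^s+1$ divides $|\{Q=1\}|=(q-S_1)/p$,
while $p^m\equiv-1$ modulo $p^s+1$.

The weight of the word of $(a,b)$ is $|D_i|$ minus its number of zeros. If $b\notin\mathbb{F}_p$,
then $\mathrm{Tr}(x)$ and $\mathrm{Tr}(bx)$ are independent and the weight is constant. If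
$b=\beta\in\mathbb{F}_p$, zeros are counted by points of $Q=1$ on the hyperplanes
$\mathrm{Tr}(ax)=-\beta c$, $c\in C_i$. By nondegeneracy $\mathrm{Tr}(ax)=B(w,x)$ with $B$ the polar
form and $w=\varphi(a)$, and the count depends on the number of roots of $Q(w)t^2-\beta ct+1$
(`card_level_hyperplane`). Because $-1$ is a non-square, the sum over $c\in C_i$ depends only on
whether $Q(w)$ is a square and whether $\beta=0$, not on $i$ (`two_mul_sum_card_roots`). The
multiplicities come from the sizes of the level sets of $Q$. -/

open Finset ZMod

/-- A surjective additive map between finite groups has fibres of equal size. -/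
lemma card_fiber_mul_card {V W : Type*} [AddCommGroup V] [Fintype V] [AddCommGroup W] [Fintype W]
    [DecidableEq W] (f : V →+ W) (hf : Function.Surjective f) (w : W) :
    #{x | f x = w} * Fintype.card W = Fintype.card V := by
  have h : ∀ w', #{x | f x = w'} = #{x | f x = w} := fun w' =>
    AddMonoidHom.card_fiber_eq_of_mem_range f (hf w') (hf w)
  have := card_eq_sum_card_fiberwise (f := f) (s := univ) (t := univ) (by simp)
  rw [sum_congr rfl fun w' _ => h w', sum_const, card_univ, card_univ, smul_eq_mul] at this
  rw [this, mul_comm]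

/-! ### Character sums and level sets of quadratic forms -/

section Forms

variable {p : ℕ} [Fact p.Prime] {V : Type*} [AddCommGroup V] [Module (ZMod p) V]

lemma linearForm_surjective {f : V →ₗ[ZMod p] ZMod p} (hf : f ≠ 0) : Function.Surjective f := by
  rcases LinearMap.surjective_or_eq_zero f with h | h
  · exact h
  · exact absurd h hf

variable [Fintype V]

lemma sum_stdAddChar_linearForm {f : V →ₗ[ZMod p] ZMod p} (hf : f ≠ 0) :
    ∑ x, stdAddChar (f x) = (0 : ℂ) := by
  refine AddChar.sum_eq_zero_of_ne_one
    (ψ := (stdAddChar (N := p)).compAddMonoidHom f.toAddMonoidHom) fun h => ?_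
  obtain ⟨x, hx⟩ := linearForm_surjective hf 1
  have h1 := DFunLike.congr_fun h x
  have h2 : stdAddChar (N := p) 1 = stdAddChar (N := p) 0 := by
    rw [AddChar.map_zero_eq_one]
    simpa [hx] using h1
  exact one_ne_zero (injective_stdAddChar h2)

lemma sum_stdAddChar_mul (c : ZMod p) :
    ∑ y : ZMod p, stdAddChar (y * c) = if c = 0 then (p : ℂ) else 0 := by
  rw [AddChar.sum_mulShift c (isPrimitive_stdAddChar p), ZMod.card]
  split_ifs <;> simp

lemma sum_stdAddChar_mul_ne_zero (c : ZMod p) :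
    ∑ y : ZMod p with y ≠ 0, stdAddChar (y * c) = (if c = 0 then (p : ℂ) else 0) - 1 := by
  rw [← sum_stdAddChar_mul, filter_ne', ← add_sum_erase univ _ (mem_univ (0 : ZMod p))]
  simp

lemma sum_eq_zero_add_sum_ne_zero {M : Type*} [AddCommMonoid M] (f : ZMod p → M) :
    ∑ y, f y = f 0 + ∑ y with y ≠ 0, f y := by
  rw [filter_ne', ← add_sum_erase univ _ (mem_univ (0 : ZMod p))]

variable (Q : QuadraticForm (ZMod p) V) {S : ℂ}

/-- Gauss sums of a nondegenerate quadratic form have absolute value the square root of the size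
of the space. -/
lemma gaussSum_mul_gaussSum_neg (hQ : Q.polarBilin.Nondegenerate) :
    (∑ x, stdAddChar (Q x)) * ∑ x, stdAddChar (-Q x) = (Fintype.card V : ℂ) := by
  classical
  calc (∑ x, stdAddChar (Q x)) * ∑ x, stdAddChar (-Q x)
      = ∑ x, ∑ h, (stdAddChar (Q (x + h)) * stdAddChar (-Q x) : ℂ) := by
        rw [sum_mul_sum, sum_comm]
        refine sum_congr rfl fun x _ => ?_
        exact (Equiv.sum_comp (Equiv.addLeft x)
          (fun y => (stdAddChar (Q y) * stdAddChar (-Q x) : ℂ))).symm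
    -- Since $Q(x+h)-Q(x)=Q(h)+B(h,x)$, the inner sum is over a linear form, which is zero only for
    -- $h=0$.
    _ = ∑ h, stdAddChar (Q h) * ∑ x, (stdAddChar (Q.polarBilin h x) : ℂ) := by
        rw [sum_comm]
        refine sum_congr rfl fun h _ => ?_
        rw [mul_sum]
        refine sum_congr rfl fun x _ => ?_
        rw [← AddChar.map_add_eq_mul, ← AddChar.map_add_eq_mul]
        congr 1
        rw [QuadraticMap.polarBilin_apply_apply, QuadraticMap.polar, add_comm h x]
        ring
    _ = Fintype.card V := by
        rw [sum_eq_single 0]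
        · simp
        · intro h _ hh
          rw [sum_stdAddChar_linearForm, mul_zero]
          exact fun h0 => hh (hQ.1 h fun x => by rw [h0]; rfl)
        · simp

variable (hS : ∀ y : ZMod p, y ≠ 0 → ∑ x, stdAddChar (y * Q x) = S)

include hS in
/-- The size of the level sets of a quadratic form all of whose Gauss sums agree. -/
lemma card_level_of_gaussSum {c : ZMod p} (hc : c ≠ 0) :
    (p * #{x | Q x = c} : ℂ) = Fintype.card V - S := by
  calc (p * #{x | Q x = c} : ℂ)
      = ∑ x, ∑ y : ZMod p, stdAddChar (y * (Q x - c)) := by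
        simp_rw [sum_stdAddChar_mul, sub_eq_zero]
        rw [← sum_filter, sum_const, nsmul_eq_mul, mul_comm]
    _ = Fintype.card V + ∑ y : ZMod p with y ≠ 0, S * stdAddChar (y * (-c)) := by
        rw [sum_comm, sum_eq_zero_add_sum_ne_zero]
        congr 1
        · simp
        · refine sum_congr rfl fun y hy => ?_
          rw [← hS y (mem_filter.1 hy).2, sum_mul]
          refine sum_congr rfl fun x _ => ?_
          rw [← AddChar.map_add_eq_mul]
          congr 1
          ring
    _ = Fintype.card V - S := by
        rw [← mul_sum, sum_stdAddChar_mul_ne_zero, if_neg (neg_ne_zero.2 hc)]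
        ring

include hS in
/-- The number of points of an affine quadric `Q = 1` on an affine hyperplane, for a quadratic form
all of whose Gauss sums agree. -/
lemma card_level_hyperplane (w : V) (hw : Q.polarBilin w ≠ 0) (c : ZMod p) :
    (p ^ 2 * #{x | Q x = 1 ∧ Q.polarBilin w x = c} : ℂ)
      = Fintype.card V + p * S * (#{t : ZMod p | Q w * t ^ 2 + c * t + 1 = 0} - 1) := by
  have hfib : (p * #{x | Q.polarBilin w x = c} : ℂ) = Fintype.card V := by
    have := card_fiber_mul_card (Q.polarBilin w).toAddMonoidHom (linearForm_surjective hw) c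
    rw [ZMod.card] at this
    rw [← this]
    push_cast
    rw [mul_comm]
    rfl
  -- Completing the square: the shift $x\mapsto x+tw$ absorbs the linear term $ytB(w,x)$ at the cost
  -- of $-yt^2Q(w)$.
  have hfac (y t : ZMod p) (hy : y ≠ 0) :
      ∑ x, stdAddChar (y * (Q x - 1) + y * t * (Q.polarBilin w x - c))
        = S * stdAddChar (y * (-(Q w * t ^ 2 + c * t + 1))) := by
    rw [← hS y hy, ← Equiv.sum_comp (Equiv.addRight (t • w))
      (fun x => (stdAddChar (y * Q x) : ℂ)), sum_mul]
    refine sum_congr rfl fun x _ => ?_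
    rw [← AddChar.map_add_eq_mul]
    congr 1
    have h : Q (x + t • w) = Q x + t * t * Q w + t * Q.polarBilin w x := by
      have := QuadraticMap.map_add Q x (t • w)
      rw [this, QuadraticMap.map_smul, QuadraticMap.polar_smul_right, QuadraticMap.polar_comm]
      simp
    rw [Equiv.coe_addRight, h]
    ring
  calc (p ^ 2 * #{x | Q x = 1 ∧ Q.polarBilin w x = c} : ℂ)
      = ∑ x, ∑ y : ZMod p, stdAddChar (y * (Q x - 1)) *
          if Q.polarBilin w x = c then (p : ℂ) else 0 := by
        simp_rw [← sum_mul, sum_stdAddChar_mul, sub_eq_zero]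
        simp_rw [ite_mul, zero_mul, mul_ite, mul_zero, ← ite_and]
        rw [← sum_filter, sum_const, nsmul_eq_mul, mul_comm]
        ring
    _ = Fintype.card V + ∑ y : ZMod p with y ≠ 0, ∑ t : ZMod p,
          S * stdAddChar (y * (-(Q w * t ^ 2 + c * t + 1))) := by
        rw [sum_comm, sum_eq_zero_add_sum_ne_zero]
        congr 1
        · simp only [zero_mul, AddChar.map_zero_eq_one, one_mul]
          rw [← sum_filter, sum_const, nsmul_eq_mul, mul_comm, hfib]
        · refine sum_congr rfl fun y hy => ?_
          have hy := (mem_filter.1 hy).2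
          simp_rw [← hfac y _ hy]
          rw [sum_comm]
          refine sum_congr rfl fun x _ => ?_
          simp_rw [AddChar.map_add_eq_mul]
          rw [← mul_sum]
          congr 1
          -- For $y\ne0$ the second character variable may be scaled to $yt$, so that $y$ factors
          -- out of the whole exponent and summing over $y$ detects the roots $t$.
          have := sum_stdAddChar_mul (y * (Q.polarBilin w x - c))
          simp only [mul_eq_zero, or_iff_right hy, sub_eq_zero] at this
          rw [← this]
          refine sum_congr rfl fun t _ => ?_
          congr 1
          ring
    _ = Fintype.card V + S * ∑ t : ZMod p,
          ((if Q w * t ^ 2 + c * t + 1 = 0 then (p : ℂ) else 0) - 1) := by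
        rw [sum_comm]
        simp_rw [← mul_sum, sum_stdAddChar_mul_ne_zero, neg_eq_zero]
    _ = _ := by
        rw [sum_sub_distrib, ← sum_filter, sum_const, sum_const, card_univ, ZMod.card]
        simp only [nsmul_eq_mul]
        ring

end Forms

/-! ### Squares and non-squares when $-1$ is a non-square -/

section Squares

variable {p : ℕ} [Fact p.Prime]

lemma not_isSquare_neg_one_of_mod_four (hp : p % 4 = 3) : ¬ IsSquare (-1 : ZMod p) := by
  rw [ZMod.exists_sq_eq_neg_one_iff]
  simpa using hp

lemma isSquare_neg_iff (hp : p % 4 = 3) {c : ZMod p} (hc : c ≠ 0) :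
    IsSquare (-c) ↔ ¬ IsSquare c := by
  have h2 : ringChar (ZMod p) ≠ 2 := by
    rw [ZMod.ringChar_zmod_n]
    rintro rfl
    omega
  have h1 := (quadraticChar_neg_one_iff_not_isSquare).2 (not_isSquare_neg_one_of_mod_four hp)
  rw [← quadraticChar_neg_one_iff_not_isSquare,
    ← quadraticChar_one_iff_isSquare (neg_ne_zero.2 hc), neg_eq_neg_one_mul, map_mul, h1]
  constructor <;> intro h <;> linarith

noncomputable instance (i : Fin 2) : DecidablePred (· ∈ cyclotomicClass p i) := fun _ => Classical.dec _

lemma neg_mem_cyclotomicClass_iff (hp : p % 4 = 3) {c : ZMod p} (hc : c ≠ 0) (i : Fin 2) :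
    -c ∈ cyclotomicClass p i ↔ c ∉ cyclotomicClass p i := by
  simp only [cyclotomicClass, Set.mem_ofPred_eq, neg_ne_zero, isSquare_neg_iff hp hc]
  tauto

/-- An odd function with nonzero values takes its values equally often in both classes. -/
lemma two_mul_card_cyclotomicClass_of_odd (hp : p % 4 = 3) (i : Fin 2) {ι : Type*}
    (s : Finset ι) (f : ι → ZMod p) (σ : ι → ι) (hσ : ∀ t ∈ s, σ t ∈ s)
    (hσσ : ∀ t ∈ s, σ (σ t) = t) (hf : ∀ t ∈ s, f (σ t) = -f t) (h0 : ∀ t ∈ s, f t ≠ 0) :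
    2 * #{t ∈ s | f t ∈ cyclotomicClass p i} = #s := by
  rw [← card_filter_add_card_filter_not (s := s) (fun t => f t ∈ cyclotomicClass p i), two_mul]
  congr 1
  -- Negation exchanges the two classes, so $\sigma$ matches the indices with values in one class to
  -- the remaining ones.
  refine card_nbij' σ σ ?_ ?_ ?_ ?_
  · intro t ht
    simp only [coe_filter, Set.mem_ofPred_eq] at ht ⊢
    refine ⟨hσ t ht.1, ?_⟩
    rw [hf t ht.1, neg_mem_cyclotomicClass_iff hp (h0 t ht.1)]
    exact not_not.2 ht.2
  · intro t ht
    simp only [coe_filter, Set.mem_ofPred_eq] at ht ⊢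
    refine ⟨hσ t ht.1, ?_⟩
    rw [hf t ht.1, neg_mem_cyclotomicClass_iff hp (h0 t ht.1)]
    exact ht.2
  · intro t ht
    exact hσσ t (mem_filter.1 ht).1
  · intro t ht
    exact hσσ t (mem_filter.1 ht).1

lemma two_mul_card_cyclotomicClass (hp : p % 4 = 3) (i : Fin 2) :
    2 * #{c : ZMod p | c ∈ cyclotomicClass p i} = p - 1 := by
  have := two_mul_card_cyclotomicClass_of_odd hp i (univ.filter fun c : ZMod p => c ≠ 0) id
    (fun c => -c) (by simp) (by simp) (by simp) (by simp)
  rw [filter_ne', card_erase_of_mem (mem_univ _), card_univ, ZMod.card] at this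
  rw [← this]
  congr 2
  ext c
  simp only [mem_filter, mem_univ, true_and, mem_erase, and_true, id]
  exact ⟨fun h => ⟨h.1, h⟩, fun h => h.2⟩

/-- The number of roots of `v t ^ 2 + 1`. -/
lemma card_roots_mul_sq_add_one (hp : p % 4 = 3) (v : ZMod p) [Decidable (IsSquare v)] :
    #{t : ZMod p | v * t ^ 2 + 1 = 0} = if IsSquare v then 0 else 2 := by
  split_ifs with hv
  · rw [card_eq_zero, filter_eq_empty_iff]
    rintro t - ht
    obtain ⟨r, rfl⟩ := hv
    exact not_isSquare_neg_one_of_mod_four hp ⟨r * t, by linear_combination -ht⟩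
  -- Here $-v=r^2$, so $vt^2+1=1-(rt)^2$ has the roots $\pm r^{-1}$.
  · have hv0 : v ≠ 0 := fun h => hv (h ▸ IsSquare.zero)
    obtain ⟨r, hr⟩ := (isSquare_neg_iff hp hv0).2 hv
    have hr0 : r ≠ 0 := by
      rintro rfl
      exact hv0 (by simpa using hr)
    have h2 : (2 : ZMod p) ≠ 0 := by
      intro h
      have h' : ((2 : ℕ) : ZMod p) = 0 := by exact_mod_cast h
      have := Nat.le_of_dvd two_pos ((ZMod.natCast_eq_zero_iff 2 p).1 h')
      have := (Fact.out : p.Prime).two_le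
      omega
    have : ({t : ZMod p | v * t ^ 2 + 1 = 0} : Finset (ZMod p)) = {r⁻¹, -r⁻¹} := by
      ext t
      have : v = -(r * r) := by rw [← hr, neg_neg]
      simp only [mem_filter, mem_univ, true_and, mem_insert, mem_singleton]
      constructor
      · intro h
        have h' : (t * r - 1) * (t * r + 1) = 0 := by
          rw [this] at h
          linear_combination -h
        rcases mul_eq_zero.1 h' with h' | h'
        · left
          exact eq_inv_of_mul_eq_one_left (by linear_combination h')
        · right
          rw [← inv_neg]
          exact eq_inv_of_mul_eq_one_left (by linear_combination -h')
      · rintro (rfl | rfl) <;> rw [this] <;> field_simp <;> ring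
    rw [this, card_pair]
    intro h
    have : 2 * r⁻¹ = 0 := by linear_combination h
    exact mul_ne_zero h2 (inv_ne_zero hr0) this

/-- Summing the number of roots of `v t ^ 2 + β c t + 1` over `c` in a cyclotomic class. -/
lemma two_mul_sum_card_roots (hp : p % 4 = 3) (i : Fin 2) (v : ZMod p) {β : ZMod p} (hβ : β ≠ 0) :
    2 * ∑ c : ZMod p with c ∈ cyclotomicClass p i, #{t : ZMod p | v * t ^ 2 + (β * c) * t + 1 = 0}
      + #{t : ZMod p | v * t ^ 2 + 1 = 0} = p - 1 := by
  have h1 : ∑ c : ZMod p with c ∈ cyclotomicClass p i,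
      #{t : ZMod p | v * t ^ 2 + (β * c) * t + 1 = 0}
      = #{t ∈ ({t : ZMod p | t ≠ 0 ∧ v * t ^ 2 + 1 ≠ 0} : Finset (ZMod p)) |
          -(v * t ^ 2 + 1) / (β * t) ∈ cyclotomicClass p i} := by
    -- A root $t$ is nonzero and determines $c$ as an odd function of $t$; the condition $c\ne0$
    -- excludes the roots of $vt^2+1$.
    rw [card_eq_sum_card_fiberwise (f := fun t => -(v * t ^ 2 + 1) / (β * t))
      (t := {c : ZMod p | c ∈ cyclotomicClass p i})]
    · refine sum_congr rfl fun c hc => ?_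
      congr 1
      ext t
      have hc := (mem_filter.1 hc).2
      have hc0 : c ≠ 0 := hc.1
      simp only [mem_filter, mem_univ, true_and]
      constructor
      · intro h
        have ht : t ≠ 0 := by
          rintro rfl
          simp at h
        have he : -(v * t ^ 2 + 1) / (β * t) = c := by
          rw [div_eq_iff (mul_ne_zero hβ ht)]
          linear_combination -h
        refine ⟨⟨⟨ht, fun h0 => ?_⟩, he ▸ hc⟩, he⟩
        rw [h0, neg_zero, zero_div] at he
        exact hc0 he.symm
      · rintro ⟨⟨⟨ht, -⟩, -⟩, he⟩
        rw [div_eq_iff (mul_ne_zero hβ ht)] at he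
        linear_combination -he
    · intro t ht
      simp only [coe_filter, mem_filter, Set.mem_ofPred_eq, mem_univ, true_and] at ht ⊢
      exact ht.2
  rw [h1, two_mul_card_cyclotomicClass_of_odd hp i _ _ (fun t => -t)]
  · have : ({t : ZMod p | t ≠ 0} : Finset (ZMod p)).card = p - 1 := by
      rw [filter_ne', card_erase_of_mem (mem_univ _), card_univ, ZMod.card]
    rw [← this, ← card_filter_add_card_filter_not (s := {t : ZMod p | t ≠ 0})
      (fun t => v * t ^ 2 + 1 ≠ 0), filter_filter, filter_filter]
    congr 2
    ext t
    simp only [mem_filter, mem_univ, true_and, not_not]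
    refine ⟨fun h => ⟨?_, h⟩, fun h => h.2⟩
    rintro rfl
    simp at h
  · simp
  · simp
  · intro t _
    rw [neg_sq, mul_neg, div_neg]
  · intro t ht
    simp only [mem_filter, mem_univ, true_and] at ht
    exact div_ne_zero (neg_ne_zero.2 ht.2) (mul_ne_zero hβ ht.1)

end Squares

/-! ### Parity and divisibility of the exponents -/

section Arithmetic

lemma exists_odd_factors {e m l : ℕ} (he : e = 2 * m) (hl : 1 ≤ l)
    (hes : Even (e / l.gcd e)) (hms : Odd (m / l.gcd e)) :
    ∃ s k j, 1 ≤ s ∧ Odd k ∧ Odd j ∧ m = s * k ∧ l = s * j := by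
  have hs : 0 < l.gcd e := Nat.gcd_pos_of_pos_left _ hl
  obtain ⟨c, hc⟩ := hes
  have h1 : e = l.gcd e * (c + c) := by
    rw [← hc, Nat.mul_div_cancel' (Nat.gcd_dvd_right l e)]
  have hmk : m = l.gcd e * c := by
    have : 2 * m = 2 * (l.gcd e * c) := by
      rw [← he]
      linarith
    omega
  have hk : m / l.gcd e = c := Nat.div_eq_of_eq_mul_right hs hmk
  refine ⟨l.gcd e, c, l / l.gcd e, hs, hk ▸ hms, ?_, hmk,
    (Nat.mul_div_cancel' (Nat.gcd_dvd_left l e)).symm⟩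
  -- The quotient $l/s$ is coprime to the even number $e/s$, hence odd.
  have hcop := Nat.coprime_div_gcd_div_gcd hs
  rw [hc] at hcop
  rw [← Nat.not_even_iff_odd]
  intro h2
  have := Nat.dvd_gcd h2.two_dvd (Dvd.intro c (two_mul c) : 2 ∣ c + c)
  rw [hcop] at this
  omega

/-- If `m / s` and `l / s` are odd, a common divisor of `p ^ l + 1` and `p ^ (2 m) - 1`
divides `p ^ m + 1`. -/
lemma dvd_pow_add_one_of_dvd {p s k j r : ℕ} (hp : 0 < p) (hk : Odd k) (hj : Odd j)
    (h1 : r ∣ p ^ (s * j) + 1) (h2 : r ∣ p ^ (2 * (s * k)) - 1) : r ∣ p ^ (s * k) + 1 := by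
  have h1' : ((p : ZMod r)) ^ (s * j) = -1 := by
    have := (ZMod.natCast_eq_zero_iff _ _).2 h1
    push_cast at this
    exact eq_neg_of_add_eq_zero_left this
  have h2' : ((p : ZMod r)) ^ (2 * (s * k)) = 1 := by
    have := (ZMod.natCast_eq_zero_iff _ _).2 h2
    rw [Nat.cast_sub (Nat.one_le_pow _ _ hp)] at this
    push_cast at this
    exact sub_eq_zero.1 this
  rw [← ZMod.natCast_eq_zero_iff]
  push_cast
  obtain ⟨c, rfl⟩ := hj
  have h3 : (p : ZMod r) ^ (s * k) = -1 := by
    calc (p : ZMod r) ^ (s * k) = ((p : ZMod r) ^ (2 * (s * k))) ^ c * (p : ZMod r) ^ (s * k) := by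
          rw [h2', one_pow, one_mul]
      _ = ((p : ZMod r) ^ (s * (2 * c + 1))) ^ k := by ring
      _ = -1 := by rw [h1', hk.neg_one_pow]
  rw [h3, neg_add_cancel]

end Arithmetic

/-! ### The form $\mathrm{Tr}(x^{p^l+1})$ and its Gauss sums -/

section TraceForm

variable {p : ℕ} [Fact p.Prime] {F : Type*} [Field F] [Fintype F] [Algebra (ZMod p) F]

lemma frobeniusAlgEquiv_pow_apply (k : ℕ) (x : F) :
    (FiniteField.frobeniusAlgEquivOfAlgebraic (ZMod p) F ^ k) x = x ^ p ^ k := by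
  rw [AlgEquiv.coe_pow, FiniteField.coe_frobeniusAlgEquivOfAlgebraic_iterate, ZMod.card]

lemma trace_pow_char_pow (k : ℕ) (x : F) :
    Algebra.trace (ZMod p) F (x ^ p ^ k) = Algebra.trace (ZMod p) F x := by
  rw [← frobeniusAlgEquiv_pow_apply, Algebra.trace_eq_of_algEquiv]

variable (p F) in
/-- The quadratic form `x ↦ Tr (x ^ (p ^ l + 1))`. -/
noncomputable def frobeniusTraceForm (l : ℕ) : QuadraticForm (ZMod p) F :=
  LinearMap.BilinMap.toQuadraticMap ((Algebra.traceForm (ZMod p) F).compl₂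
    (FiniteField.frobeniusAlgEquivOfAlgebraic (ZMod p) F ^ l).toLinearMap)

lemma frobeniusTraceForm_apply (l : ℕ) (x : F) :
    frobeniusTraceForm p F l x = Algebra.trace (ZMod p) F (x ^ (p ^ l + 1)) := by
  rw [frobeniusTraceForm, LinearMap.BilinMap.toQuadraticMap_apply, LinearMap.compl₂_apply,
    Algebra.traceForm_apply, AlgEquiv.toLinearMap_apply, frobeniusAlgEquiv_pow_apply, pow_succ']

lemma polarBilin_frobeniusTraceForm_apply (l : ℕ) (x y : F) :
    (frobeniusTraceForm p F l).polarBilin x y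
      = Algebra.trace (ZMod p) F (x * y ^ p ^ l) + Algebra.trace (ZMod p) F (y * x ^ p ^ l) := by
  simp only [frobeniusTraceForm, QuadraticMap.polarBilin_apply_apply,
    LinearMap.BilinMap.polar_toQuadraticMap, LinearMap.compl₂_apply, Algebra.traceForm_apply,
    AlgEquiv.toLinearMap_apply, frobeniusAlgEquiv_pow_apply]

variable {s k j : ℕ} (hk : Odd k) (hj : Odd j) (hp : p ≠ 2)
  (hF : Fintype.card F = p ^ (2 * (s * k)))

-- Iterating the relation $k$ times gives $w^{q^j}=(-1)^kw=-w$, whereas $w^{q^j}=w$. This says that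
-- the radical of the trace form is zero.
include hF hk hp in
lemma eq_zero_of_pow_eq_neg {w : F} (hw : w ^ p ^ (2 * (s * j)) = -w) : w = 0 := by
  have hodd : Odd p := (Fact.out : p.Prime).odd_of_ne_two hp
  have hiter (n : ℕ) : w ^ p ^ (2 * (s * j) * n) = (-1) ^ n * w := by
    induction n with
    | zero => simp
    | succ n ih =>
      rw [mul_add, mul_one, pow_add, pow_mul, ih, mul_pow, hw, ← pow_mul, mul_comm n, pow_mul,
        hodd.pow.neg_one_pow]
      ring
  have h1 := hiter k
  rw [hk.neg_one_pow, show 2 * (s * j) * k = 2 * (s * k) * j by ring, pow_mul, ← hF,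
    FiniteField.pow_card_pow] at h1
  have : CharP F p := charP_of_injective_algebraMap (algebraMap (ZMod p) F).injective p
  have h2 : (2 : F) ≠ 0 := Ring.two_ne_zero (by rwa [ringChar.eq F p])
  have h3 : 2 * w = 0 := by linear_combination h1
  exact (mul_eq_zero.1 h3).resolve_left h2

include hF hk hp in
/-- The quadratic form `Tr (x ^ (p ^ l + 1))` is nondegenerate when `m / s` is odd. -/
lemma nondegenerate_frobeniusTraceForm :
    (frobeniusTraceForm p F (s * j)).polarBilin.Nondegenerate := by
  have key (w : F) (h : ∀ x, (frobeniusTraceForm p F (s * j)).polarBilin w x = 0) : w = 0 := by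
    refine eq_zero_of_pow_eq_neg (j := j) hk hp hF ?_
    rw [← add_eq_zero_iff_eq_neg, add_comm]
    refine (traceForm_nondegenerate (ZMod p) F).1 _ fun y => ?_
    rw [Algebra.traceForm_apply]
    -- With $P=p^{sj}$, Frobenius invariance of the trace gives
    -- $B(w,x)=\mathrm{Tr}((w+w^{P^2})x^P)$, and $x^P$ runs through all of $F$.
    obtain ⟨x, rfl⟩ := (FiniteField.frobeniusAlgEquivOfAlgebraic (ZMod p) F ^ (s * j)).surjective y
    rw [frobeniusAlgEquiv_pow_apply, add_mul, map_add, ← h x, polarBilin_frobeniusTraceForm_apply,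
      ← trace_pow_char_pow (s * j) (x * w ^ p ^ (s * j)), mul_pow, ← pow_mul, ← pow_add, ← two_mul,
      mul_comm (x ^ _)]
  refine ⟨key, fun w h => key w fun x => ?_⟩
  rw [← h x, QuadraticMap.polarBilin_apply_apply, QuadraticMap.polarBilin_apply_apply,
    QuadraticMap.polar_comm]

include hF hk hj in
/-- Every nonzero element of the prime field is a `(p ^ l + 1)`-th power. -/
lemma exists_pow_eq_algebraMap {y : ZMod p} (hy : y ≠ 0) :
    ∃ g : F, g ≠ 0 ∧ g ^ (p ^ (s * j) + 1) = algebraMap (ZMod p) F y := by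
  have hp1 : 1 < p := (Fact.out : p.Prime).one_lt
  obtain ⟨z, hz⟩ := FiniteField.norm_surjective (ZMod p) F y
  have hz0 : z ≠ 0 := by
    rintro rfl
    exact hy (by rw [← hz, Algebra.norm_zero])
  have hq := FiniteField.algebraMap_norm_eq_pow (K := ZMod p) (x := z)
  rw [hz, Nat.card_eq_fintype_card, hF, Nat.card_zmod] at hq
  set q := p ^ (2 * (s * k)) with hqdef
  set d := p ^ (s * j) + 1
  -- The norm of $z$ is $z^{(q-1)/(p-1)}$; it is a $d$-th power once $\gcd(d,q-1)$ divides this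
  -- exponent.
  have hr : d.gcd (q - 1) ∣ (q - 1) / (p - 1) := by
    have h1 : d.gcd (q - 1) ∣ p ^ (s * k) + 1 :=
      dvd_pow_add_one_of_dvd (by omega) hk hj (Nat.gcd_dvd_left _ _) (Nat.gcd_dvd_right _ _)
    have h2 : p - 1 ∣ p ^ (s * k) - 1 := by
      simpa using Nat.sub_dvd_pow_sub_pow p 1 (s * k)
    have h3 : q - 1 = (p ^ (s * k) + 1) * (p ^ (s * k) - 1) := by
      rw [hqdef, mul_comm 2, pow_mul]
      simpa using Nat.sq_sub_sq (p ^ (s * k)) 1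
    have h4 : (q - 1) / (p - 1) = (p ^ (s * k) + 1) * ((p ^ (s * k) - 1) / (p - 1)) := by
      rw [h3, Nat.mul_div_assoc _ h2]
    rw [h4]
    exact h1.mul_right _
  obtain ⟨c, hc⟩ := hr
  lift z to Fˣ using hz0.isUnit
  have hzq : z ^ (q - 1) = 1 := by
    rw [← hF, ← Nat.card_eq_fintype_card, ← Nat.card_units]
    exact pow_card_eq_one'
  -- Bézout: the exponent is $c\gcd(d,q-1)$, congruent modulo $q-1$ to $d$ times $c$ and the Bézout
  -- coefficient of $d$.
  refine ⟨((z ^ (c * d.gcdA (q - 1)) : Fˣ) : F), Units.ne_zero _, ?_⟩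
  rw [hq, ← Units.val_pow_eq_pow_val, ← Units.val_pow_eq_pow_val, Units.val_inj, hc,
    ← zpow_natCast, ← zpow_natCast, ← zpow_mul]
  push_cast
  rw [Nat.gcd_eq_gcd_ab, show ((d : ℤ) * d.gcdA (q - 1) + ((q - 1 : ℕ) : ℤ) * d.gcdB (q - 1)) * c
    = c * d.gcdA (q - 1) * d + ((q - 1 : ℕ) : ℤ) * (d.gcdB (q - 1) * c) by ring, zpow_add,
    zpow_mul z ((q - 1 : ℕ) : ℤ), zpow_natCast, hzq, one_zpow, mul_one]

include hF in
/-- The level set of `Tr (x ^ (p ^ l + 1))` is a union of cosets of the group of solutions of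
`u ^ (p ^ l + 1) = 1`. -/
lemma gcd_dvd_card_level (d : ℕ) (hd : d ≠ 0) :
    (p ^ (2 * (s * k)) - 1).gcd d ∣ #{x : F | Algebra.trace (ZMod p) F (x ^ d) = 1} := by
  classical
  have h1 : #{x : F | Algebra.trace (ZMod p) F (x ^ d) = 1}
      = #{u : Fˣ | Algebra.trace (ZMod p) F ((u : F) ^ d) = 1} := by
    refine (card_bij (fun (u : Fˣ) _ => (u : F)) ?_ ?_ ?_).symm
    · simp
    · intro a _ b _ h
      exact Units.ext h
    · intro x hx
      have hx := (mem_filter.1 hx).2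
      have hx0 : x ≠ 0 := by
        rintro rfl
        rw [zero_pow hd, map_zero] at hx
        exact zero_ne_one hx
      exact ⟨Units.mk0 x hx0, by simpa using hx, rfl⟩
  have h2 : (p ^ (2 * (s * k)) - 1).gcd d = #{u : Fˣ | u ^ d = 1} := by
    have := IsCyclic.card_powMonoidHom_ker Fˣ d
    rw [Nat.card_units, Nat.card_eq_fintype_card (α := F), hF] at this
    rw [← this, ← Fintype.card_subtype, ← Nat.card_eq_fintype_card]
    rfl
  rw [h1, h2, card_eq_sum_card_image (fun u : Fˣ => u ^ d)
    {u : Fˣ | Algebra.trace (ZMod p) F ((u : F) ^ d) = 1}]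
  refine dvd_sum fun z hz => ?_
  obtain ⟨v, hv, rfl⟩ := mem_image.1 hz
  have h3 : #{u : Fˣ | u ^ d = 1} = #{u : Fˣ | u ^ d = v ^ d} :=
    MonoidHom.card_fiber_eq_of_mem_range (powMonoidHom d : Fˣ →* Fˣ) ⟨1, by simp⟩ ⟨v, rfl⟩
  rw [h3, filter_filter]
  refine dvd_of_eq (congrArg card (filter_congr fun u _ => ?_))
  refine ⟨fun h => ⟨?_, h⟩, fun h => h.2⟩
  rw [← Units.val_pow_eq_pow_val, h, Units.val_pow_eq_pow_val]
  exact (mem_filter.1 hv).2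

include hF hk hj hp in
/-- The Gauss sum of the quadratic form `Tr (x ^ (p ^ l + 1))`. -/
lemma gaussSum_frobeniusTraceForm (hs : 1 ≤ s) (y : ZMod p) (hy : y ≠ 0) :
    ∑ x, stdAddChar (y * frobeniusTraceForm p F (s * j) x) = -(p : ℂ) ^ (s * k) := by
  have hp3 : 3 ≤ p := by
    have := (Fact.out : p.Prime).two_le
    omega
  set Q := frobeniusTraceForm p F (s * j) with hQ
  set S : ℂ := ∑ x, stdAddChar (Q x) with hSdef
  have hS (y : ZMod p) (hy : y ≠ 0) : ∑ x, stdAddChar (y * Q x) = S := by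
    obtain ⟨g, hg, hgy⟩ := exists_pow_eq_algebraMap hk hj hF hy
    rw [hSdef, ← Equiv.sum_comp (Equiv.mulLeft₀ g hg) (fun x => (stdAddChar (Q x) : ℂ))]
    refine sum_congr rfl fun x _ => ?_
    congr 1
    rw [hQ, frobeniusTraceForm_apply, frobeniusTraceForm_apply, Equiv.mulLeft₀_apply, mul_pow, hgy,
      ← Algebra.smul_def, _root_.map_smul, smul_eq_mul]
  -- The Gauss sums at $1$ and $-1$ agree, so their product, the size of $F$, is a square $S^2$.
  have hsq : S * S = ((p : ℂ) ^ (s * k)) * (p : ℂ) ^ (s * k) := by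
    have h1 := gaussSum_mul_gaussSum_neg Q (nondegenerate_frobeniusTraceForm (j := j) hk hp hF)
    have h2 := hS (-1) (neg_ne_zero.2 one_ne_zero)
    simp_rw [neg_one_mul] at h2
    rw [h2, hF] at h1
    rw [hSdef, h1]
    push_cast
    ring
  rw [hS y hy]
  refine (mul_self_eq_mul_self_iff.1 hsq).resolve_left fun hpos => ?_
  have hN := card_level_of_gaussSum Q hS one_ne_zero
  rw [hpos, hF] at hN
  have hN' : p * #{x | Q x = 1} + p ^ (s * k) = p ^ (s * k) * p ^ (s * k) := by
    have : ((p * #{x | Q x = 1} + p ^ (s * k) : ℕ) : ℂ) = ((p ^ (s * k) * p ^ (s * k) : ℕ) : ℂ) := by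
      push_cast
      rw [hN]
      push_cast
      ring
    exact_mod_cast this
  have hd1 : p ^ s + 1 ∣ p ^ (s * j) + 1 := by
    have := hj.nat_add_dvd_pow_add_pow (p ^ s) 1
    rwa [one_pow, ← pow_mul] at this
  have hd2 : p ^ s + 1 ∣ p ^ (s * k) + 1 := by
    have := hk.nat_add_dvd_pow_add_pow (p ^ s) 1
    rwa [one_pow, ← pow_mul] at this
  have hd3 : p ^ s + 1 ∣ p ^ (2 * (s * k)) - 1 := by
    have : p ^ (2 * (s * k)) - 1 = (p ^ (s * k) + 1) * (p ^ (s * k) - 1) := by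
      rw [mul_comm 2, pow_mul]
      simpa using Nat.sq_sub_sq (p ^ (s * k)) 1
    rw [this]
    exact hd2.mul_right _
  have hd4 : p ^ s + 1 ∣ #{x | Q x = 1} := by
    simp_rw [hQ, frobeniusTraceForm_apply]
    exact (Nat.dvd_gcd hd3 hd1).trans (gcd_dvd_card_level hF _ (Nat.succ_ne_zero _))
  -- If $S=p^m$, then `hN'` reduces modulo $p^s+1$ to $-1=1$, impossible because $p^s+1>2$.
  have hz1 : ((p : ZMod (p ^ s + 1))) ^ (s * k) = -1 := by
    have := (ZMod.natCast_eq_zero_iff _ _).2 hd2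
    push_cast at this
    exact eq_neg_of_add_eq_zero_left this
  have hz2 := congrArg (Nat.cast : ℕ → ZMod (p ^ s + 1)) hN'
  push_cast at hz2
  rw [(ZMod.natCast_eq_zero_iff _ _).2 hd4, hz1] at hz2
  have hz3 : ((2 : ℕ) : ZMod (p ^ s + 1)) = 0 := by
    push_cast
    linear_combination -hz2
  have := Nat.le_of_dvd two_pos ((ZMod.natCast_eq_zero_iff _ _).1 hz3)
  have := Nat.le_self_pow (by omega : s ≠ 0) p
  omega

end TraceForm

/-! ### Counting the zeros of a codeword -/

section Counting

variable {p : ℕ} [Fact p.Prime] {F : Type*} [Field F] [Fintype F] [Algebra (ZMod p) F]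
  {s k j : ℕ} (hp : p % 4 = 3) (hk : Odd k) (hj : Odd j) (hs : 1 ≤ s)
  (hF : Fintype.card F = p ^ (2 * (s * k)))

omit [Fact p.Prime] in
include hp in
lemma ne_two_of_mod_four : p ≠ 2 := by
  rintro rfl
  omega

include hp hk hj hs hF in
lemma card_level_frobeniusTraceForm {c : ZMod p} (hc : c ≠ 0) :
    (#{x | frobeniusTraceForm p F (s * j) x = c} : ℚ)
      = ((p : ℚ) ^ (s * k) * p ^ (s * k) + p ^ (s * k)) / p := by
  have hp0 : (p : ℚ) ≠ 0 := by exact_mod_cast (Fact.out : p.Prime).ne_zero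
  have h := card_level_of_gaussSum (frobeniusTraceForm p F (s * j))
    (gaussSum_frobeniusTraceForm hk hj (ne_two_of_mod_four hp) hF hs) hc
  rw [hF] at h
  rw [eq_div_iff hp0]
  have h' : ((p * #{x | frobeniusTraceForm p F (s * j) x = c} : ℕ) : ℂ)
      = ((p ^ (s * k) * p ^ (s * k) + p ^ (s * k) : ℕ) : ℂ) := by
    push_cast
    rw [h]
    push_cast
    ring
  rw [mul_comm]
  exact_mod_cast h'

include hp hk hj hs hF in
lemma card_level_hyperplane_frobeniusTraceForm {w : F} (hw : w ≠ 0) (c : ZMod p) :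
    (#{x | frobeniusTraceForm p F (s * j) x = 1 ∧
        (frobeniusTraceForm p F (s * j)).polarBilin w x = c} : ℚ)
      = ((p : ℚ) ^ (s * k) * p ^ (s * k) + p * p ^ (s * k)
        - p * p ^ (s * k) *
          #{t : ZMod p | frobeniusTraceForm p F (s * j) w * t ^ 2 + c * t + 1 = 0}) / p ^ 2 := by
  have hp0 : (p : ℚ) ≠ 0 := by exact_mod_cast (Fact.out : p.Prime).ne_zero
  have hnd := nondegenerate_frobeniusTraceForm (j := j) hk (ne_two_of_mod_four hp) hF
  have h := card_level_hyperplane (frobeniusTraceForm p F (s * j))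
    (gaussSum_frobeniusTraceForm hk hj (ne_two_of_mod_four hp) hF hs) w
    (fun h0 => hw (hnd.1 w fun x => by rw [h0]; rfl)) c
  rw [hF] at h
  rw [eq_div_iff (pow_ne_zero 2 hp0), eq_sub_iff_add_eq]
  set R := #{t : ZMod p | frobeniusTraceForm p F (s * j) w * t ^ 2 + c * t + 1 = 0}
  set N := #{x | frobeniusTraceForm p F (s * j) x = 1 ∧
        (frobeniusTraceForm p F (s * j)).polarBilin w x = c}
  have h' : ((N * p ^ 2 + p * p ^ (s * k) * R : ℕ) : ℂ)
      = ((p ^ (s * k) * p ^ (s * k) + p * p ^ (s * k) : ℕ) : ℂ) := by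
    push_cast
    rw [mul_comm (N : ℂ), h]
    push_cast
    ring
  exact_mod_cast h'

/-- Two nondegenerate bilinear forms differ by a linear automorphism. -/
lemma exists_linearEquiv_apply_eq {K V : Type*} [Field K] [AddCommGroup V] [Module K V]
    [FiniteDimensional K V] {A B : LinearMap.BilinForm K V} (hA : A.Nondegenerate)
    (hB : B.Nondegenerate) : ∃ φ : V ≃ₗ[K] V, ∀ a x, A a x = B (φ a) x :=
  ⟨(A.toDual hA).trans (B.toDual hB).symm, fun a x => by
    rw [LinearEquiv.trans_apply, LinearMap.BilinForm.apply_toDual_symm_apply,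
      LinearMap.BilinForm.toDual_def]⟩

include hF in
lemma card_trace_eq (c : ZMod p) :
    (#{x : F | Algebra.trace (ZMod p) F x = c} : ℚ) = (p : ℚ) ^ (s * k) * p ^ (s * k) / p := by
  have hp0 : (p : ℚ) ≠ 0 := by exact_mod_cast (Fact.out : p.Prime).ne_zero
  have h := card_fiber_mul_card (Algebra.trace (ZMod p) F).toAddMonoidHom
    (Algebra.trace_surjective (ZMod p) F) c
  rw [ZMod.card, hF, mul_comm 2, pow_mul, sq] at h
  rw [eq_div_iff hp0]
  exact_mod_cast h

/-- Otherwise a nonzero functional $(u,v)\mapsto\alpha u+\gamma v$ kills the image, so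
$\mathrm{Tr}((\alpha+\gamma b)x)=0$ for all $x$. Then $\alpha+\gamma b=0$, which forces
$b\in\mathbb{F}_p$. -/
lemma trace_prod_surjective {b : F} (hb : b ∉ Set.range (algebraMap (ZMod p) F)) :
    Function.Surjective ((Algebra.trace (ZMod p) F).prod
      ((Algebra.trace (ZMod p) F).comp (LinearMap.mulLeft (ZMod p) b))) := by
  rw [← LinearMap.range_eq_top]
  by_contra hne
  obtain ⟨f, hf, hle⟩ := Submodule.exists_le_ker_of_lt_top _ (lt_top_iff_ne_top.2 hne)
  have hfx (u v : ZMod p) : f (u, v) = u * f (1, 0) + v * f (0, 1) := by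
    rw [← smul_eq_mul, ← smul_eq_mul, ← _root_.map_smul, ← _root_.map_smul, ← map_add]
    simp
  have hz : algebraMap (ZMod p) F (f (1, 0)) + algebraMap (ZMod p) F (f (0, 1)) * b = 0 := by
    refine (traceForm_nondegenerate (ZMod p) F).1 _ fun x => ?_
    have h : f (Algebra.trace (ZMod p) F x, Algebra.trace (ZMod p) F (b * x)) = 0 :=
      hle (LinearMap.mem_range_self _ x)
    rw [hfx] at h
    rw [Algebra.traceForm_apply, add_mul, mul_assoc, ← Algebra.smul_def, ← Algebra.smul_def,
      map_add, _root_.map_smul, _root_.map_smul, smul_eq_mul, smul_eq_mul]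
    linear_combination h
  by_cases h1 : f (0, 1) = 0
  · have h0 : f (1, 0) = 0 := by simpa [h1] using hz
    refine hf (LinearMap.ext fun x => ?_)
    rw [← Prod.mk.eta (p := x), hfx, h0, h1]
    simp
  · refine hb ⟨-(f (1, 0) / f (0, 1)), ?_⟩
    have h1' : algebraMap (ZMod p) F (f (0, 1)) ≠ 0 := by simpa using h1
    rw [map_neg, map_div₀, ← neg_div, div_eq_iff h1']
    linear_combination -hz

include hF in
lemma card_trace_eq_and_trace_mul_eq {b : F} (hb : b ∉ Set.range (algebraMap (ZMod p) F))
    (c u : ZMod p) :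
    (#{x : F | Algebra.trace (ZMod p) F x = c ∧ Algebra.trace (ZMod p) F (b * x) = u} : ℚ)
      = (p : ℚ) ^ (s * k) * p ^ (s * k) / p ^ 2 := by
  have hp0 : (p : ℚ) ≠ 0 := by exact_mod_cast (Fact.out : p.Prime).ne_zero
  have h := card_fiber_mul_card ((Algebra.trace (ZMod p) F).prod
      ((Algebra.trace (ZMod p) F).comp (LinearMap.mulLeft (ZMod p) b))).toAddMonoidHom
    (trace_prod_surjective hb) (c, u)
  rw [Fintype.card_prod, ZMod.card, hF, mul_comm 2, pow_mul, sq] at h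
  rw [eq_div_iff (pow_ne_zero 2 hp0), sq (p : ℚ)]
  have h2 : #{x : F | Algebra.trace (ZMod p) F x = c ∧ Algebra.trace (ZMod p) F (b * x) = u}
      * (p * p) = p ^ (s * k) * p ^ (s * k) := by
    rw [← h]
    congr 2
    ext x
    simp
  exact_mod_cast h2

lemma mem_definingSet {l : ℕ} {i : Fin 2} {x : F × F} :
    x ∈ definingSet p F l i ↔ frobeniusTraceForm p F l x.1 = 1 ∧
      Algebra.trace (ZMod p) F x.2 ∈ cyclotomicClass p i := by
  simp [definingSet, frobeniusTraceForm_apply]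

/-- The number of vanishing coordinates of a codeword, split according to the values of the
traces. -/
lemma card_zero_coordinates (l : ℕ) (i : Fin 2) (a b : F) :
    #{x ∈ definingSet p F l i | Algebra.trace (ZMod p) F (a * x.1 + b * x.2) = 0}
      = ∑ c : ZMod p with c ∈ cyclotomicClass p i, ∑ u : ZMod p,
        #{x : F | frobeniusTraceForm p F l x = 1 ∧ Algebra.trace (ZMod p) F (a * x) = u} *
        #{x : F | Algebra.trace (ZMod p) F x = c ∧ Algebra.trace (ZMod p) F (b * x) = -u} := by
  rw [card_eq_sum_card_fiberwise (f := fun x => Algebra.trace (ZMod p) F x.2)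
      (t := {c : ZMod p | c ∈ cyclotomicClass p i})]
  · refine sum_congr rfl fun c hc => ?_
    rw [card_eq_sum_card_fiberwise (f := fun x => Algebra.trace (ZMod p) F (a * x.1))
      (t := univ) (by simp)]
    refine sum_congr rfl fun u _ => ?_
    rw [← card_product]
    congr 1
    ext x
    have hc := (mem_filter.1 hc).2
    simp only [mem_filter, mem_product, mem_univ, true_and, mem_definingSet, map_add]
    constructor
    · rintro ⟨⟨⟨⟨h1, -⟩, h2⟩, h3⟩, h4⟩
      exact ⟨⟨h1, h4⟩, h3, by linear_combination h2 - h4⟩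
    · rintro ⟨⟨h1, h4⟩, h3, h5⟩
      exact ⟨⟨⟨⟨h1, h3 ▸ hc⟩, by rw [h4, h5, add_neg_cancel]⟩, h3⟩, h4⟩
  · intro x hx
    simp only [coe_filter, mem_definingSet, Set.mem_ofPred_eq, mem_univ, true_and] at hx ⊢
    exact hx.1.2

-- For scalar $b=\beta$ the value $\mathrm{Tr}(\beta x_2)=\beta c$ is fixed by $c$, so only
-- $u=-\beta c$ contributes, with a full trace fibre as second factor.
include hF in
lemma card_zero_coordinates_algebraMap (l : ℕ) (i : Fin 2) (a : F) (β : ZMod p) :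
    (#{x ∈ definingSet p F l i |
        Algebra.trace (ZMod p) F (a * x.1 + algebraMap (ZMod p) F β * x.2) = 0} : ℚ)
      = (p : ℚ) ^ (s * k) * p ^ (s * k) / p * ∑ c : ZMod p with c ∈ cyclotomicClass p i,
        (#{x : F | frobeniusTraceForm p F l x = 1 ∧
          Algebra.trace (ZMod p) F (a * x) = (-β) * c} : ℚ) := by
  rw [card_zero_coordinates, Nat.cast_sum, mul_sum]
  refine sum_congr rfl fun c _ => ?_
  rw [sum_eq_single ((-β) * c)]
  · rw [Nat.cast_mul, mul_comm, ← card_trace_eq hF c]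
    congr 4
    ext x
    rw [← Algebra.smul_def, _root_.map_smul, smul_eq_mul]
    refine ⟨fun h => h.1, fun h => ⟨h, ?_⟩⟩
    rw [h, neg_mul, neg_neg]
  · intro u _ hu
    convert mul_zero _
    rw [card_eq_zero, filter_eq_empty_iff]
    rintro x - ⟨rfl, h2⟩
    rw [← Algebra.smul_def, _root_.map_smul, smul_eq_mul] at h2
    exact hu (by rw [neg_mul, h2, neg_neg])
  · simp

include hp in
lemma card_cyclotomicClass (i : Fin 2) :
    (#{c : ZMod p | c ∈ cyclotomicClass p i} : ℚ) = (p - 1) / 2 := by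
  have h := two_mul_card_cyclotomicClass hp i
  have h1 := (Fact.out : p.Prime).one_le
  have h2 : 2 * #{c : ZMod p | c ∈ cyclotomicClass p i} + 1 = p := by omega
  have h3 : (2 * #{c : ZMod p | c ∈ cyclotomicClass p i} + 1 : ℚ) = p := by exact_mod_cast h2
  linarith

include hp hk hj hs hF in
lemma card_definingSet (i : Fin 2) :
    ((definingSet p F (s * j) i).card : ℚ) = (p - 1) / 2 *
      (((p : ℚ) ^ (s * k) * p ^ (s * k) + p ^ (s * k)) / p) *
      ((p : ℚ) ^ (s * k) * p ^ (s * k) / p) := by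
  -- The zero word vanishes at every coordinate, so its zeros count the defining set.
  have h := card_zero_coordinates_algebraMap hF (s * j) i (0 : F) 0
  simp only [zero_mul, map_zero, add_zero, neg_zero, and_true, filter_true,
    card_level_frobeniusTraceForm hp hk hj hs hF one_ne_zero, sum_const,
    card_cyclotomicClass hp, nsmul_eq_mul] at h
  rw [h]
  ring

-- The second factor in each term is the constant $q/p^2$, so summing over $u$ restores the whole
-- level set $Q=1$ and $a$ drops out.
include hp hk hj hs hF in
lemma card_zero_coordinates_of_notMem_range (i : Fin 2) (a : F) {b : F}
    (hb : b ∉ Set.range (algebraMap (ZMod p) F)) :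
    (#{x ∈ definingSet p F (s * j) i | Algebra.trace (ZMod p) F (a * x.1 + b * x.2) = 0} : ℚ)
      = (p - 1) / 2 * (((p : ℚ) ^ (s * k) * p ^ (s * k) + p ^ (s * k)) / p) *
      ((p : ℚ) ^ (s * k) * p ^ (s * k) / p ^ 2) := by
  rw [card_zero_coordinates]
  push_cast
  simp_rw [card_trace_eq_and_trace_mul_eq hF hb, ← sum_mul]
  have h : ∑ u : ZMod p, (#{x : F | frobeniusTraceForm p F (s * j) x = 1 ∧
      Algebra.trace (ZMod p) F (a * x) = u} : ℚ)
      = #{x : F | frobeniusTraceForm p F (s * j) x = 1} := by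
    rw [card_eq_sum_card_fiberwise (f := fun x => Algebra.trace (ZMod p) F (a * x))
      (t := univ) (by simp)]
    push_cast
    simp_rw [filter_filter]
  rw [h, card_level_frobeniusTraceForm hp hk hj hs hF one_ne_zero, sum_const,
    nsmul_eq_mul, card_cyclotomicClass hp]

lemma card_zero_coordinates_zero_left (l : ℕ) (i : Fin 2) {β : ZMod p} (hβ : β ≠ 0) :
    #{x ∈ definingSet p F l i |
        Algebra.trace (ZMod p) F (0 * x.1 + algebraMap (ZMod p) F β * x.2) = 0} = 0 := by
  rw [card_eq_zero, filter_eq_empty_iff]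
  intro x hx
  rw [zero_mul, zero_add, ← Algebra.smul_def, _root_.map_smul, smul_eq_mul]
  exact mul_ne_zero hβ (mem_definingSet.1 hx).2.1

end Counting

/-! ### Zeros for scalar $b$ and nonzero $a$ -/

section Weights

variable {p : ℕ} [Fact p.Prime] {F : Type*} [Field F] [Fintype F] [Algebra (ZMod p) F]
  {s k j : ℕ} (hp : p % 4 = 3) (hk : Odd k) (hj : Odd j) (hs : 1 ≤ s)
  (hF : Fintype.card F = p ^ (2 * (s * k)))
  (φ : F ≃ₗ[ZMod p] F) (hφ : ∀ a x, Algebra.traceForm (ZMod p) F a x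
    = (frobeniusTraceForm p F (s * j)).polarBilin (φ a) x)

include hp hk hj hs hF hφ in
lemma card_zero_coordinates_zero_right (i : Fin 2) {a : F} (ha : a ≠ 0)
    [Decidable (IsSquare (frobeniusTraceForm p F (s * j) (φ a)))] :
    (#{x ∈ definingSet p F (s * j) i |
        Algebra.trace (ZMod p) F (a * x.1 + algebraMap (ZMod p) F 0 * x.2) = 0} : ℚ)
      = (p : ℚ) ^ (s * k) * p ^ (s * k) / p * ((p - 1) / 2 *
        (((p : ℚ) ^ (s * k) * p ^ (s * k) + p * p ^ (s * k) - p * p ^ (s * k) *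
          if IsSquare (frobeniusTraceForm p F (s * j) (φ a)) then 0 else 2) / p ^ 2)) := by
  rw [card_zero_coordinates_algebraMap hF]
  have hφa : φ a ≠ 0 := by simpa using ha
  simp_rw [← Algebra.traceForm_apply, hφ, neg_zero, zero_mul,
    card_level_hyperplane_frobeniusTraceForm hp hk hj hs hF hφa, zero_mul, add_zero,
    card_roots_mul_sq_add_one hp]
  rw [sum_const, nsmul_eq_mul, card_cyclotomicClass hp]
  push_cast
  rfl

include hp hk hj hs hF hφ in
lemma card_zero_coordinates_of_ne_zero (i : Fin 2) {a : F} (ha : a ≠ 0) {β : ZMod p} (hβ : β ≠ 0)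
    [Decidable (IsSquare (frobeniusTraceForm p F (s * j) (φ a)))] :
    (#{x ∈ definingSet p F (s * j) i |
        Algebra.trace (ZMod p) F (a * x.1 + algebraMap (ZMod p) F β * x.2) = 0} : ℚ)
      = (p : ℚ) ^ (s * k) * p ^ (s * k) / p * (((p - 1) / 2 *
        ((p : ℚ) ^ (s * k) * p ^ (s * k)) + p * p ^ (s * k) *
          if IsSquare (frobeniusTraceForm p F (s * j) (φ a)) then 0 else 1) / p ^ 2) := by
  rw [card_zero_coordinates_algebraMap hF]
  have hφa : φ a ≠ 0 := by simpa using ha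
  have hR := two_mul_sum_card_roots hp i (frobeniusTraceForm p F (s * j) (φ a)) (neg_ne_zero.2 hβ)
  rw [card_roots_mul_sq_add_one hp] at hR
  have hR' : (2 * ∑ c : ZMod p with c ∈ cyclotomicClass p i,
      (#{t : ZMod p | frobeniusTraceForm p F (s * j) (φ a) * t ^ 2 + (-β * c) * t + 1 = 0} : ℚ))
      = p - 1 - 2 * if IsSquare (frobeniusTraceForm p F (s * j) (φ a)) then 0 else 1 := by
    have h1 := (Fact.out : p.Prime).one_le
    have hR' := congrArg (Nat.cast : ℕ → ℚ) hR
    rw [Nat.cast_sub h1] at hR'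
    push_cast at hR'
    rw [← hR']
    split_ifs <;> ring
  simp_rw [← Algebra.traceForm_apply, hφ,
    card_level_hyperplane_frobeniusTraceForm hp hk hj hs hF hφa]
  rw [← sum_div, sum_sub_distrib, ← mul_sum, sum_const, nsmul_eq_mul, card_cyclotomicClass hp]
  congr 2
  -- The total number of roots is $(p-1)/2$, less one if $Q(\varphi(a))$ is a non-square; its main
  -- part cancels the term $p\cdot p^m(p-1)/2$.
  linear_combination (-(p : ℚ) * p ^ (s * k) / 2) * hR'

end Weights

/-! ### Rewriting the table in $p$ and $p^m$ -/

section Table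

/-- The table of weights with all powers expressed through `p` and `p ^ m`. -/
lemma weightTable_two_mul {p m : ℕ} (hp : p ≠ 0) (hm : 1 ≤ m) :
    weightTable p (2 * m) m =
      let P : ℚ := p
      let M : ℚ := p ^ m
      ![(0, 1),
        ((P - 1) / 2 * (M ^ 4 / P ^ 2 + M ^ 3 / P ^ 2), P - 1),
        ((P - 1) ^ 2 / 2 * (M ^ 4 / P ^ 3 + M ^ 3 / P ^ 3), M ^ 2 * (M ^ 2 - P)),
        ((P - 1) ^ 2 / 2 * (M ^ 4 / P ^ 3), (M ^ 2 + M ^ 2 / P - M + M / P - 2) / 2),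
        ((P - 1) ^ 2 / 2 * (M ^ 4 / P ^ 3) + (P - 1) * (M ^ 3 / P ^ 2),
          (M ^ 2 - M ^ 2 / P + M - M / P) / 2),
        ((P - 1) ^ 2 / 2 * (M ^ 4 / P ^ 3) + (P - 1) / 2 * (M ^ 3 / P ^ 2),
          (P - 1) * (M ^ 2 + M ^ 2 / P - M + M / P - 2) / 2),
        ((P - 1) ^ 2 / 2 * (M ^ 4 / P ^ 3) + (P - 3) / 2 * (M ^ 3 / P ^ 2),
          (P - 1) * (M ^ 2 - M ^ 2 / P + M - M / P) / 2)] := by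
  have hp0 : (p : ℚ) ≠ 0 := by exact_mod_cast hp
  -- As $m\ge1$, none of the truncated subtractions in the exponents loses anything.
  have hpow (a n c : ℕ) (h : a + c = m * n) : (p : ℚ) ^ a = ((p : ℚ) ^ m) ^ n / (p : ℚ) ^ c := by
    rw [eq_div_iff (pow_ne_zero c hp0), ← pow_add, h, pow_mul]
  have h1 := hpow (2 * (2 * m) - 2) 4 2 (by omega)
  have h2 := hpow (2 * m + m - 2) 3 2 (by omega)
  have h3 := hpow (2 * (2 * m) - 3) 4 3 (by omega)
  have h4 := hpow (2 * m + m - 3) 3 3 (by omega)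
  have h5 := hpow (2 * m - 1) 2 1 (by omega)
  have h6 := hpow (m - 1) 1 1 (by omega)
  have h7 := hpow (2 * m) 2 0 (by omega)
  rw [weightTable, h1, h2, h3, h4, h5, h6, h7]
  simp only [pow_one, pow_zero, div_one]

end Table

/-! ### Sorting coefficient pairs into the rows of the table -/

section Classification

variable {p : ℕ} [Fact p.Prime] {F : Type*} [Field F] [Fintype F] [Algebra (ZMod p) F]
  {s k j : ℕ} (hp : p % 4 = 3) (hk : Odd k) (hj : Odd j) (hs : 1 ≤ s)
  (hF : Fintype.card F = p ^ (2 * (s * k)))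
  (φ : F ≃ₗ[ZMod p] F) (hφ : ∀ a x, Algebra.traceForm (ZMod p) F a x
    = (frobeniusTraceForm p F (s * j)).polarBilin (φ a) x)

open Classical in
/-- The row of the weight table that a pair of coefficients belongs to. -/
noncomputable def weightRow (l : ℕ) (φ : F ≃ₗ[ZMod p] F) (x : F × F) : Fin 7 :=
  if x.2 = 0 then
    if x.1 = 0 then 0
    else if IsSquare (frobeniusTraceForm p F l (φ x.1)) then 3 else 4
  else if x.2 ∈ Set.range (algebraMap (ZMod p) F) then
    if x.1 = 0 then 1
    else if IsSquare (frobeniusTraceForm p F l (φ x.1)) then 5 else 6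
  else 2

lemma weightRow_eq_zero_iff {l : ℕ} {x : F × F} : weightRow (p := p) l φ x = 0 ↔ x = 0 := by
  rw [weightRow, Prod.ext_iff, Prod.fst_zero, Prod.snd_zero]
  split_ifs <;> simp [*]

include hp hk hj hs hF hφ in
/-- The weight of a codeword is the one in its row of the table. -/
lemma card_ne_zero_coordinates (i : Fin 2) (a b : F) :
    (#{x ∈ definingSet p F (s * j) i | Algebra.trace (ZMod p) F (a * x.1 + b * x.2) ≠ 0} : ℚ)
      = (weightTable p (2 * (s * k)) (s * k) (weightRow (s * j) φ (a, b))).1 := by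
  classical
  have hp0 : (p : ℚ) ≠ 0 := by exact_mod_cast (Fact.out : p.Prime).ne_zero
  have hM : (p : ℚ) ^ (s * k) ≠ 0 := pow_ne_zero _ hp0
  have hsplit : (#{x ∈ definingSet p F (s * j) i |
        Algebra.trace (ZMod p) F (a * x.1 + b * x.2) ≠ 0} : ℚ)
      = (definingSet p F (s * j) i).card - #{x ∈ definingSet p F (s * j) i |
        Algebra.trace (ZMod p) F (a * x.1 + b * x.2) = 0} := by
    rw [eq_sub_iff_add_eq', ← Nat.cast_add, card_filter_add_card_filter_not]
  rw [hsplit, card_definingSet hp hk hj hs hF,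
    weightTable_two_mul (Fact.out : p.Prime).ne_zero (Nat.mul_pos hs hk.pos), weightRow]
  by_cases hb : b ∈ Set.range (algebraMap (ZMod p) F)
  · obtain ⟨β, rfl⟩ := hb
    by_cases hβ : β = 0
    · subst hβ
      by_cases ha : a = 0
      · subst ha
        have : ({x ∈ definingSet p F (s * j) i | Algebra.trace (ZMod p) F
            (0 * x.1 + algebraMap (ZMod p) F 0 * x.2) = 0} : Finset (F × F))
            = definingSet p F (s * j) i := by
          simp
        rw [this, card_definingSet hp hk hj hs hF]
        simp
      · rw [card_zero_coordinates_zero_right hp hk hj hs hF φ hφ i ha]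
        by_cases hv : IsSquare (frobeniusTraceForm p F (s * j) (φ a))
        · simp [ha, hv]
          field_simp
          ring
        · simp [ha, hv]
          field_simp
          ring
    · have hβ' : algebraMap (ZMod p) F β ≠ 0 := by simpa using hβ
      by_cases ha : a = 0
      · subst ha
        rw [card_zero_coordinates_zero_left _ i hβ]
        simp [hβ]
        field_simp
      · rw [card_zero_coordinates_of_ne_zero hp hk hj hs hF φ hφ i ha hβ]
        by_cases hv : IsSquare (frobeniusTraceForm p F (s * j) (φ a))
        · simp [ha, hv, hβ]
          field_simp
          ring
        · simp [ha, hv, hβ]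
          field_simp
          ring
  · have hb0 : b ≠ 0 := by
      rintro rfl
      exact hb ⟨0, map_zero _⟩
    rw [card_zero_coordinates_of_notMem_range hp hk hj hs hF i a hb, if_neg hb0, if_neg hb]
    simp
    field_simp

-- All level sets of $Q$ at nonzero values have the same size, and $\varphi$ is a bijection; there
-- are $(p-1)/2$ non-squares.
include hp hk hj hs hF in
lemma card_not_isSquare (P : F → Prop) [DecidablePred P]
    (hP : ∀ a, P a ↔ ¬ IsSquare (frobeniusTraceForm p F (s * j) (φ a))) :
    (#{a | P a} : ℚ)
      = (p - 1) / 2 * (((p : ℚ) ^ (s * k) * p ^ (s * k) + p ^ (s * k)) / p) := by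
  have h : #{a | P a} = ∑ c : ZMod p with c ∈ cyclotomicClass p 1,
      #{x : F | frobeniusTraceForm p F (s * j) x = c} := by
    rw [card_eq_sum_card_fiberwise (f := fun a => frobeniusTraceForm p F (s * j) (φ a))
      (t := {c : ZMod p | c ∈ cyclotomicClass p 1})]
    · refine sum_congr rfl fun c hc => ?_
      have hc := (mem_filter.1 hc).2
      refine card_equiv φ.toEquiv fun a => ?_
      simp only [mem_filter, mem_univ, true_and, hP]
      refine ⟨fun h => h.2, fun h => ⟨?_, h⟩⟩
      have h' : frobeniusTraceForm p F (s * j) (φ a) = c := h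
      rw [h', hc.2]
      decide
    · intro a ha
      simp only [coe_filter, mem_univ, true_and, Set.mem_ofPred_eq, hP] at ha ⊢
      refine ⟨fun h => ha (h ▸ IsSquare.zero), iff_of_false ha (by decide)⟩
  rw [h, Nat.cast_sum, sum_congr rfl fun c hc => card_level_frobeniusTraceForm hp hk hj hs hF
    (mem_filter.1 hc).2.1, sum_const, nsmul_eq_mul, card_cyclotomicClass hp]

lemma card_mem_range_ne_zero (P : F → Prop) [DecidablePred P]
    (hP : ∀ b, P b ↔ b ≠ 0 ∧ b ∈ Set.range (algebraMap (ZMod p) F)) :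
    (#{b | P b} : ℚ) = p - 1 := by
  have : #{b | P b} = #{β : ZMod p | β ≠ 0} := by
    refine (card_bij (fun β _ => algebraMap (ZMod p) F β) ?_ ?_ ?_).symm
    · intro β hβ
      simpa [hP] using hβ
    · intro β _ γ _ h
      exact (algebraMap (ZMod p) F).injective h
    · intro b hb
      obtain ⟨h0, β, rfl⟩ := (hP b).1 (mem_filter.1 hb).2
      exact ⟨β, by simpa using h0, rfl⟩
  rw [this, filter_ne', card_erase_of_mem (mem_univ _), card_univ, ZMod.card,
    Nat.cast_sub (Fact.out : p.Prime).one_le, Nat.cast_one]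

/-- Each row is a condition on $a$ times a condition on $b$, whence the `True` in row 2, so that its
size is a product. In rows 4 and 6, $a\ne0$ is implied, zero being a square. -/
lemma row_eq_iff {X Y A B : Prop} [Decidable X] [Decidable Y] [Decidable A] [Decidable B]
    (hA : X → A) (hB : Y → B) :
    let r : Fin 7 := if Y then if X then 0 else if A then 3 else 4
      else if B then if X then 1 else if A then 5 else 6 else 2
    (r = 0 ↔ X ∧ Y) ∧ (r = 1 ↔ X ∧ ¬ Y ∧ B) ∧ (r = 2 ↔ True ∧ ¬ B) ∧ (r = 3 ↔ (¬ X ∧ A) ∧ Y) ∧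
    (r = 4 ↔ ¬ A ∧ Y) ∧ (r = 5 ↔ (¬ X ∧ A) ∧ ¬ Y ∧ B) ∧ (r = 6 ↔ ¬ A ∧ ¬ Y ∧ B) := by
  by_cases hx : X <;> by_cases hy : Y <;> by_cases ha : A <;> by_cases hb : B <;>
    simp [hx, hy, ha, hb] at hA hB ⊢

lemma weightRow_eq_iff (l : ℕ) (a b : F) :
    (weightRow l φ (a, b) = 0 ↔ a = 0 ∧ b = 0) ∧
    (weightRow l φ (a, b) = 1 ↔ a = 0 ∧ b ≠ 0 ∧ b ∈ Set.range (algebraMap (ZMod p) F)) ∧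
    (weightRow l φ (a, b) = 2 ↔ True ∧ b ∉ Set.range (algebraMap (ZMod p) F)) ∧
    (weightRow l φ (a, b) = 3 ↔ (a ≠ 0 ∧ IsSquare (frobeniusTraceForm p F l (φ a))) ∧ b = 0) ∧
    (weightRow l φ (a, b) = 4 ↔ ¬ IsSquare (frobeniusTraceForm p F l (φ a)) ∧ b = 0) ∧
    (weightRow l φ (a, b) = 5 ↔ (a ≠ 0 ∧ IsSquare (frobeniusTraceForm p F l (φ a))) ∧
      b ≠ 0 ∧ b ∈ Set.range (algebraMap (ZMod p) F)) ∧
    (weightRow l φ (a, b) = 6 ↔ ¬ IsSquare (frobeniusTraceForm p F l (φ a)) ∧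
      b ≠ 0 ∧ b ∈ Set.range (algebraMap (ZMod p) F)) := by
  have hsq : a = 0 → IsSquare (frobeniusTraceForm p F l (φ a)) := by
    rintro rfl
    simp
  have hmem : b = 0 → b ∈ Set.range (algebraMap (ZMod p) F) := by
    rintro rfl
    exact ⟨0, map_zero _⟩
  classical
  exact row_eq_iff hsq hmem

omit [Fact p.Prime] [Field F] [Algebra (ZMod p) F] in
include hF in
lemma cast_card_eq : (Fintype.card F : ℚ) = (p : ℚ) ^ (s * k) * p ^ (s * k) := by
  rw [hF]
  push_cast
  ring

include hp hk hj hs hF in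
lemma card_ne_zero_and_isSquare (P : F → Prop) [DecidablePred P]
    (hP : ∀ a, P a ↔ a ≠ 0 ∧ IsSquare (frobeniusTraceForm p F (s * j) (φ a))) :
    (#{a | P a} : ℚ) = (p : ℚ) ^ (s * k) * p ^ (s * k) - 1
      - (p - 1) / 2 * (((p : ℚ) ^ (s * k) * p ^ (s * k) + p ^ (s * k)) / p) := by
  classical
  have h1 := card_filter_add_card_filter_not (s := univ)
    (fun a => IsSquare (frobeniusTraceForm p F (s * j) (φ a)))
  have h2 : #{a | P a} + 1 = #{a | IsSquare (frobeniusTraceForm p F (s * j) (φ a))} := by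
    rw [← card_erase_add_one (s := {a | IsSquare (frobeniusTraceForm p F (s * j) (φ a))})
      (a := 0) (by simp)]
    congr 2
    ext a
    simp [hP]
  rw [← h2, card_univ] at h1
  rw [← card_not_isSquare hp hk hj hs hF φ
    (fun a => ¬ IsSquare (frobeniusTraceForm p F (s * j) (φ a))) fun a => Iff.rfl,
    ← cast_card_eq hF, ← h1]
  push_cast
  ring

include hF in
lemma card_notMem_range (P : F → Prop) [DecidablePred P]
    (hP : ∀ b, P b ↔ b ∉ Set.range (algebraMap (ZMod p) F)) :
    (#{b | P b} : ℚ) = (p : ℚ) ^ (s * k) * p ^ (s * k) - p := by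
  classical
  have h1 := card_filter_add_card_filter_not (s := univ) P
  have h2 : #{b | ¬ P b} = p := by
    have h3 : ({b | ¬ P b} : Finset F) = univ.image (algebraMap (ZMod p) F) := by
      ext b
      simp [hP]
    rw [h3, card_image_of_injective _ (algebraMap (ZMod p) F).injective, card_univ, ZMod.card]
  rw [h2, card_univ] at h1
  rw [← cast_card_eq hF, ← h1]
  push_cast
  ring

lemma card_weightRow_eq_mul (l : ℕ) (r : Fin 7) (A B : F → Prop) [DecidablePred A]
    [DecidablePred B] (h : ∀ a b, weightRow l φ (a, b) = r ↔ A a ∧ B b) :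
    (#{x : F × F | weightRow l φ x = r} : ℚ) = #{a | A a} * #{b | B b} := by
  rw [← Nat.cast_mul, ← card_product]
  congr 2
  ext ⟨a, b⟩
  simp [h]

include hp hk hj hs hF in
/-- The number of pairs of coefficients in a row of the table. -/
lemma card_weightRow (r : Fin 7) :
    (#{x : F × F | weightRow (s * j) φ x = r} : ℚ)
      = (weightTable p (2 * (s * k)) (s * k) r).2 := by
  classical
  have hp0 : (p : ℚ) ≠ 0 := by exact_mod_cast (Fact.out : p.Prime).ne_zero
  have hM : (p : ℚ) ^ (s * k) ≠ 0 := pow_ne_zero _ hp0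
  have hN := card_not_isSquare hp hk hj hs hF φ
    (fun a => ¬ IsSquare (frobeniusTraceForm p F (s * j) (φ a))) fun a => Iff.rfl
  have hR := card_mem_range_ne_zero (p := p)
    (fun b : F => b ≠ 0 ∧ b ∈ Set.range (algebraMap (ZMod p) F)) fun b => Iff.rfl
  have hB := card_notMem_range hF
    (fun b : F => b ∉ Set.range (algebraMap (ZMod p) F)) fun b => Iff.rfl
  have hQ := card_ne_zero_and_isSquare hp hk hj hs hF φ
    (fun a => a ≠ 0 ∧ IsSquare (frobeniusTraceForm p F (s * j) (φ a))) fun a => Iff.rfl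
  have hone : (#{a : F | a = 0} : ℚ) = 1 := by
    rw [card_eq_one.2 ⟨0, by ext; simp⟩, Nat.cast_one]
  have hrow := weightRow_eq_iff φ (s * j)
  have hmul := card_weightRow_eq_mul φ (s * j)
  rw [weightTable_two_mul (Fact.out : p.Prime).ne_zero (Nat.mul_pos hs hk.pos)]
  fin_cases r
  · refine (hmul 0 _ _ fun a b => (hrow a b).1).trans ?_
    rw [hone, mul_one]
    rfl
  · refine (hmul 1 _ _ fun a b => (hrow a b).2.1).trans ?_
    rw [hone, hR, one_mul]
    rfl
  · refine (hmul 2 _ _ fun a b => (hrow a b).2.2.1).trans ?_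
    rw [filter_true, card_univ, cast_card_eq hF, hB, ← sq]
    rfl
  · refine (hmul 3 _ _ fun a b => (hrow a b).2.2.2.1).trans ?_
    rw [hQ, hone]
    simp
    field_simp
    ring
  · refine (hmul 4 _ _ fun a b => (hrow a b).2.2.2.2.1).trans ?_
    rw [hN, hone]
    simp
    field_simp
    ring
  · refine (hmul 5 _ _ fun a b => (hrow a b).2.2.2.2.2.1).trans ?_
    rw [hQ, hR]
    simp
    field_simp
    ring
  · refine (hmul 6 _ _ fun a b => (hrow a b).2.2.2.2.2.2).trans ?_
    rw [hN, hR]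
    simp
    field_simp
    ring

end Classification

/-! ### The code as the image of a linear encoder -/

section Code

variable {p : ℕ} [Fact p.Prime] {F : Type*} [Field F] [Algebra (ZMod p) F]

/-- The codeword with given coefficients. -/
noncomputable def traceEncoder (p : ℕ) [Fact p.Prime] {F : Type*} [Field F] [Algebra (ZMod p) F]
    (D : Finset (F × F)) : F × F →ₗ[ZMod p] (D → ZMod p) where
  toFun y x := Algebra.trace (ZMod p) F (y.1 * x.1.1 + y.2 * x.1.2)
  map_add' y z := by
    ext x
    rw [Pi.add_apply, ← map_add, Prod.fst_add, Prod.snd_add]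
    congr 1
    ring
  map_smul' r y := by
    ext x
    rw [Pi.smul_apply, RingHom.id_apply, ← _root_.map_smul, Prod.smul_fst, Prod.smul_snd, smul_add,
      smul_mul_assoc, smul_mul_assoc]

lemma range_traceEncoder (D : Finset (F × F)) : (traceEncoder p D).range = traceCode p D := by
  ext c
  constructor
  · rintro ⟨y, rfl⟩
    exact ⟨y.1, y.2, fun x => rfl⟩
  · rintro ⟨a, b, h⟩
    exact ⟨(a, b), (funext h).symm⟩

lemma hammingNorm_traceEncoder (D : Finset (F × F)) (y : F × F) :
    hammingNorm (traceEncoder p D y)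
      = #{x ∈ D | Algebra.trace (ZMod p) F (y.1 * x.1 + y.2 * x.2) ≠ 0} := by
  rw [hammingNorm]
  refine card_bij (fun x _ => x.1) ?_ ?_ ?_
  · intro x hx
    exact mem_filter.2 ⟨x.2, (mem_filter.1 hx).2⟩
  · intro x _ z _ h
    exact Subtype.ext h
  · intro x hx
    obtain ⟨h1, h2⟩ := mem_filter.1 hx
    exact ⟨⟨x, h1⟩, mem_filter.2 ⟨mem_univ _, h2⟩, rfl⟩

end Code

/-! ### Weight distributions of parametrized codes -/

section LinearCode

variable {K ι V : Type*} [Field K] [DecidableEq K] [Fintype ι] [AddCommGroup V] [Module K V]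

/-- If the parameters of an injectively parametrized code are sorted into classes of constant
weight, the weight distribution is obtained by adding up the sizes of the classes. -/
lemma weightCount_range_eq_sum [Fintype V] {f : V →ₗ[K] ι → K} (hf : Function.Injective f)
    {R : Type*} [Fintype R] [DecidableEq R] (row : V → R) (wt mult : R → ℚ)
    (hwt : ∀ y, (hammingNorm (f y) : ℚ) = wt (row y))
    (hmult : ∀ r, (#{y | row y = r} : ℚ) = mult r) (w : ℕ) :
    (weightCount f.range w : ℚ) = ∑ r, if wt r = w then mult r else 0 := by
  have h1 : {c : ι → K | c ∈ f.range ∧ hammingNorm c = w}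
      = f '' ({y | hammingNorm (f y) = w} : Finset V) := by
    ext c
    simp only [Set.mem_ofPred_eq, LinearMap.mem_range, Set.mem_image, coe_filter, mem_univ,
      true_and]
    constructor
    · rintro ⟨⟨y, rfl⟩, h⟩
      exact ⟨y, h, rfl⟩
    · rintro ⟨y, h, rfl⟩
      exact ⟨⟨y, rfl⟩, h⟩
  rw [weightCount, h1, Set.ncard_image_of_injective _ hf, Set.ncard_coe_finset,
    card_eq_sum_card_fiberwise (f := row) (t := univ) (by simp), Nat.cast_sum]
  refine sum_congr rfl fun r _ => ?_
  rw [filter_filter, ← hmult]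
  split_ifs with h
  · congr 3
    ext y
    refine ⟨fun h' => h'.2, fun hy => ⟨?_, hy⟩⟩
    have := hwt y
    rw [hy, h] at this
    exact_mod_cast this
  · rw [Nat.cast_eq_zero, card_eq_zero, filter_eq_empty_iff]
    rintro y - ⟨h2, rfl⟩
    exact h (by rw [← hwt, h2])

/-- The number of nonzero weights of a code is at most the number of weights in a list of
candidates. -/
lemma ncard_nonzeroWeights_range_le {f : V →ₗ[K] ι → K} {T : Finset ℚ}
    (hT : ∀ y, hammingNorm (f y) ≠ 0 → (hammingNorm (f y) : ℚ) ∈ T) :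
    (nonzeroWeights f.range).ncard ≤ #T := by
  rw [← Set.ncard_image_of_injective _ (Nat.cast_injective (R := ℚ)), ← Set.ncard_coe_finset]
  refine Set.ncard_le_ncard ?_ T.finite_toSet
  rintro _ ⟨_, ⟨h0, _, ⟨y, rfl⟩, rfl⟩, rfl⟩
  exact hT y h0

end LinearCode

/-! ### Nonzero and coinciding weights; the main theorem -/

lemma weightTable_ne_zero {p m : ℕ} (hp : 3 ≤ p) (hm : 1 ≤ m) {r : Fin 7} (hr : r ≠ 0) :
    (weightTable p (2 * m) m r).1 ≠ 0 := by
  have hp' : (3 : ℚ) ≤ p := by exact_mod_cast hp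
  have h1 : (0 : ℚ) < p - 1 := by linarith
  have h3 : (0 : ℚ) ≤ p - 3 := by linarith
  have h0 : (0 : ℚ) < p := by linarith
  rw [weightTable_two_mul (by omega) hm]
  apply ne_of_gt
  fin_cases r
  · exact absurd rfl hr
  all_goals
    simp
    positivity

/-- For $m=1$ both weights are $p(p-1)(p+1)/2$, which leaves at most five nonzero weights. -/
lemma weightTable_one_eq_four {p : ℕ} (hp : p ≠ 0) :
    (weightTable p (2 * 1) 1 4).1 = (weightTable p (2 * 1) 1 1).1 := by
  have hp0 : (p : ℚ) ≠ 0 := by exact_mod_cast hp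
  rw [weightTable_two_mul hp le_rfl]
  simp
  field_simp
  ring

theorem theorem1 (p : ℕ) [Fact p.Prime] (hp : p % 4 = 3)
    (e m l s : ℕ) (hm : 1 ≤ m) (he : e = 2 * m) (hl : 1 ≤ l) (hs : s = Nat.gcd l e)
    (hes : Even (e / s)) (hms : Odd (m / s))
    (F : Type*) [Field F] [Fintype F] [Algebra (ZMod p) F] (hF : Fintype.card F = p ^ e)
    (i : Fin 2) :
    ((definingSet p F l i).card : ℚ)
        = ((p : ℚ) - 1) / 2 * ((p : ℚ) ^ (2 * e - 2) + (p : ℚ) ^ (e + m - 2)) ∧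
      Module.finrank (ZMod p) (traceCode p (definingSet p F l i)) = 2 * e ∧
      (∀ w : ℕ, (weightCount (traceCode p (definingSet p F l i)) w : ℚ)
        = ∑ j : Fin 7, if (weightTable p e m j).1 = (w : ℚ) then (weightTable p e m j).2 else 0) ∧
      (nonzeroWeights (traceCode p (definingSet p F l i))).ncard ≤ 6 ∧
      (m = 1 → s = 1 → (nonzeroWeights (traceCode p (definingSet p F l i))).ncard ≤ 5) := by
  subst hs
  obtain ⟨s, k, j, hs, hk, hj, hmk, hlj⟩ := exists_odd_factors he hl hes hms
  clear hes hms hl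
  subst he hlj
  have hp3 : 3 ≤ p := by omega
  have hF' : Fintype.card F = p ^ (2 * (s * k)) := by rw [hF, hmk]
  obtain ⟨φ, hφ⟩ := exists_linearEquiv_apply_eq (traceForm_nondegenerate (ZMod p) F)
    (nondegenerate_frobeniusTraceForm (j := j) hk (ne_two_of_mod_four hp) hF')
  have hwt (y : F × F) : (hammingNorm (traceEncoder p (definingSet p F (s * j) i) y) : ℚ)
      = (weightTable p (2 * m) m (weightRow (s * j) φ y)).1 := by
    rw [hammingNorm_traceEncoder, card_ne_zero_coordinates hp hk hj hs hF' φ hφ, hmk]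
  -- A nonzero pair lies in a row of nonzero weight, so its word is nonzero; this yields the
  -- dimension $2e$.
  have hinj : Function.Injective (traceEncoder p (definingSet p F (s * j) i)) := by
    refine (injective_iff_map_eq_zero _).2 fun y hy => ?_
    by_contra hy0
    refine weightTable_ne_zero hp3 hm (mt (weightRow_eq_zero_iff (l := s * j) φ).1 hy0) ?_
    rw [← hwt, hy, hammingNorm_zero, Nat.cast_zero]
  have hmem (y : F × F) (h : hammingNorm (traceEncoder p (definingSet p F (s * j) i) y) ≠ 0) :
      (hammingNorm (traceEncoder p (definingSet p F (s * j) i) y) : ℚ)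
        ∈ ({1, 2, 3, 4, 5, 6} : Finset (Fin 7)).image fun r => (weightTable p (2 * m) m r).1 := by
    rw [hwt]
    refine mem_image_of_mem _ ?_
    have h0 : weightRow (s * j) φ y ≠ 0 := fun h0 => h <| by
      rw [(weightRow_eq_zero_iff φ).1 h0, map_zero, hammingNorm_zero]
    generalize weightRow (s * j) φ y = r at h0
    revert r
    decide
  rw [← range_traceEncoder]
  refine ⟨?_, ?_, ?_, ?_, ?_⟩
  -- The length is also the weight in row 1: the words $\beta\,\mathrm{Tr}(x_2)$ with $\beta\ne0$
  -- have no zero coordinate.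
  · have h := congrArg (fun t => (t 1).1) (weightTable_two_mul (p := p) (m := m) (by omega) hm)
    simp only [weightTable, Matrix.cons_val_one, Matrix.cons_val_zero] at h
    rw [h, card_definingSet hp hk hj hs hF', ← hmk]
    field_simp
  · have hfr := Module.card_eq_pow_finrank (K := ZMod p) (V := F)
    rw [hF, ZMod.card] at hfr
    rw [LinearMap.finrank_range_of_inj hinj, Module.finrank_prod,
      ← Nat.pow_right_injective (by omega : 2 ≤ p) hfr]
    ring
  · intro w
    refine weightCount_range_eq_sum hinj (weightRow (s * j) φ)
      (fun r => (weightTable p (2 * m) m r).1) (fun r => (weightTable p (2 * m) m r).2) hwt ?_ w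
    intro r
    rw [card_weightRow hp hk hj hs hF', hmk]
  · exact (ncard_nonzeroWeights_range_le hmem).trans card_image_le
  · rintro hm1 -
    subst hm1
    refine (ncard_nonzeroWeights_range_le
      (T := ({1, 2, 3, 5, 6} : Finset (Fin 7)).image fun r => (weightTable p (2 * 1) 1 r).1)
      fun y hy => ?_).trans card_image_le
    obtain ⟨r, hr, he⟩ := mem_image.1 (hmem y hy)
    rw [← he]
    by_cases h4 : r = 4
    · rw [h4, weightTable_one_eq_four (by omega)]
      exact mem_image_of_mem _ (by decide)
    · exact mem_image_of_mem _ ((by decide : ∀ r ∈ ({1, 2, 3, 4, 5, 6} : Finset (Fin 7)),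
        r ≠ 4 → r ∈ ({1, 2, 3, 5, 6} : Finset (Fin 7))) r hr h4)
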